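/- Let $d\ge 1$, let $\mathbf N$ be the space of locally finite subsets of $\mathbb R^d$, with the $\sigma$-algebra generated by the counting functions $Y\mapsto \operatorname{card}(Y\cap A)$, $A\subset\mathbb R^d$ Borel, and let $B^d$ be the closed unit ball of $\mathbb R^d$. For $\gamma>0$ let $X_\gamma$ be a stationary Poisson point process in $\mathbb R^d$ of intensity $\gamma$. Fix $\lambda>0$ and write $X=X_\lambda$. Let $S:\mathbf N\to\mathbb R$ be measurable and let $R:\mathbf N\to\mathbb R$ and $f:\mathbb R\to\mathbb R$ be functions such that $R(X)$ is a radius of influence of $S(X)$ with bound $f$, that is: for almost every realization $Y$ of $X$ and for arbitrary locally finite point sets $D\subset\mathbb R^d$ and $D^\circ\subset\mathbb R^d\setminus R(Y)B^d$ we have $$S(Y)=S(Y\cup D^\circ)\qquad\text{and}\qquad |S(Y)-S(Y\cup D)|\le f(R(Y)).$$ Assume that $\mathbb E\,S(X_\gamma)^2<\infty$ for all $\gamma$ in a neighbourhood of $\lambda$, that the functions $\gamma\mapsto\mathbb E\,S(X_\gamma)$ and $\gamma\mapsto\mathbb E\,S(X_\gamma)^2$ are continuous at $\lambda$, and that $f(R(X))^2R(X)^{2d}$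 is integrable. Then $$\operatorname{Var} S(X)\le \mathbb E\sum_{x\in X}\bigl(S(X\setminus\{x\})-S(X)\bigr)^2,$$ where the right-hand side may be $+\infty$. -/

import Mathlib

open MeasureTheory ProbabilityTheory Filter Topology
open scoped NNReal ENNReal Pointwise

/-- The space of locally finite point sets in `ℝ^d`: every bounded set contains only finitely
many points of the set. -/
@[ext]
structure LocFinSet (d : ℕ) where
  carrier : Set (EuclideanSpace ℝ (Fin d))
  finite_inter : ∀ B : Set (EuclideanSpace ℝ (Fin d)),
    Bornology.IsBounded B → (carrier ∩ B).Finite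

namespace LocFinSet

/-- The union of two locally finite point sets. -/
instance instUnion (d : ℕ) : Union (LocFinSet d) where
  union Y D :=
    { carrier := Y.carrier ∪ D.carrier
      finite_inter := fun B hB => by
        rw [Set.union_inter_distrib_right]
        exact (Y.finite_inter B hB).union (D.finite_inter B hB) }

/-- The locally finite point set `Y ∖ {x}`. -/
def erase {d : ℕ} (Y : LocFinSet d) (x : EuclideanSpace ℝ (Fin d)) : LocFinSet d where
  carrier := Y.carrier \ {x}
  finite_inter := fun B hB =>
    (Y.finite_inter B hB).subset (Set.inter_subset_inter_left B Set.sdiff_subset)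

/-- The usual σ-algebra on the space of locally finite point sets: the smallest one for which all
counting functions `Y ↦ card (Y ∩ A)`, `A` Borel, are measurable. -/
noncomputable instance instMeasurableSpace (d : ℕ) : MeasurableSpace (LocFinSet d) :=
  ⨆ (A : Set (EuclideanSpace ℝ (Fin d))) (_ : MeasurableSet A),
    MeasurableSpace.comap (fun Y : LocFinSet d => (Y.carrier ∩ A).encard) ⊤

end LocFinSet

/-- `X` is a (stationary) Poisson point process in `ℝ^d` of intensity `γ` on the space `(Ω, P)`:
the number of points in a bounded Borel set `A` is Poisson distributed with mean `γ V(A)`, and the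
numbers of points in pairwise disjoint bounded Borel sets are independent.
(The counts are finite, so that `Set.ncard` is the true cardinality.) -/
structure IsPoissonPointProcess {d : ℕ} {Ω : Type*} [MeasurableSpace Ω] (P : Measure Ω)
    (γ : ℝ≥0) (X : Ω → LocFinSet d) : Prop where
  measurable : Measurable X
  map_count : ∀ A : Set (EuclideanSpace ℝ (Fin d)), MeasurableSet A → Bornology.IsBounded A →
    P.map (fun ω => ((X ω).carrier ∩ A).ncard) = poissonMeasure (γ * (volume A).toNNReal)
  indep_count : ∀ (n : ℕ) (A : Fin n → Set (EuclideanSpace ℝ (Fin d))),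
    (∀ i, MeasurableSet (A i)) → (∀ i, Bornology.IsBounded (A i)) →
    Pairwise (fun i j => Disjoint (A i) (A j)) →
    iIndepFun (fun (i : Fin n) (ω : Ω) => ((X ω).carrier ∩ A i).ncard) P

/-- `r` is a radius of influence of the functional `S` at the point set `Y`, with bound `f`:
adding points outside `r B^d` does not change `S Y`, and adding arbitrary points changes `S Y` by
at most `f r`. -/
def IsRadiusOfInfluence {d : ℕ} (S : LocFinSet d → ℝ) (f : ℝ → ℝ) (Y : LocFinSet d) (r : ℝ) :
    Prop :=
  (∀ D₀ : LocFinSet d,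
    D₀.carrier ⊆ (r • Metric.closedBall (0 : EuclideanSpace ℝ (Fin d)) 1)ᶜ → S Y = S (Y ∪ D₀)) ∧
  (∀ D : LocFinSet d, |S Y - S (Y ∪ D)| ≤ f r)

/-!
The inequality is the Poincaré inequality of a Poisson process, and it holds for every square
integrable functional `S X` (`IsPoissonPointProcess.variance_le_lintegral`).

Cut a bounded window `W` into small disjoint cells `B i`. The restrictions of `X` to the cells are
independent, so the Efron–Stein inequality (`IsPoissonPointProcess.variance_condExp_le_sum`) bounds
the variance of `E[S X | X ∩ W]` by `∑ i, E (S X - S (X ∖ B i))²`. A cell holding exactly one point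
`x` contributes `(S (X ∖ {x}) - S X)²`, a term of the sum over the points of `X`, and an empty cell
contributes nothing. A cell holds two or more points with probability at most the square of its
mean number of points; for bounded `S` the contribution of such cells is therefore of the order of
`vol W` times the largest volume of a cell, which tends to `0` as the cells shrink
(`IsPoissonPointProcess.variance_condExp_le_lintegral`). This uses neither the Mecke formula nor the
measurability of the sum over the points.

Lévy's upward theorem lets `W` grow to the whole space, and truncation, which does not increase
differences of `S`, removes the boundedness of `S`.
-/

/-! ### Restrictions of point sets and their measurability -/

namespace LocFinSet

variable {d : ℕ}

/-- The part `Y ∩ U` of a locally finite point set `Y` lying in `U`. -/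
def restrict (Y : LocFinSet d) (U : Set (EuclideanSpace ℝ (Fin d))) : LocFinSet d where
  carrier := Y.carrier ∩ U
  finite_inter := fun B hB =>
    (Y.finite_inter B hB).subset (Set.inter_subset_inter_left B Set.inter_subset_left)

lemma carrier_restrict (Y : LocFinSet d) (U : Set (EuclideanSpace ℝ (Fin d))) :
    (Y.restrict U).carrier = Y.carrier ∩ U := rfl

lemma restrict_restrict (Y : LocFinSet d) (U V : Set (EuclideanSpace ℝ (Fin d))) :
    (Y.restrict U).restrict V = Y.restrict (U ∩ V) := by
  ext1; simp [carrier_restrict, Set.inter_assoc]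

lemma restrict_univ (Y : LocFinSet d) : Y.restrict Set.univ = Y := by
  ext1; simp [carrier_restrict]

lemma restrict_empty (Y : LocFinSet d) : Y.restrict ∅ = ⟨∅, by simp⟩ := by
  ext1; simp [carrier_restrict]

lemma measurable_encard {A : Set (EuclideanSpace ℝ (Fin d))} (hA : MeasurableSet A) :
    Measurable fun Y : LocFinSet d => (Y.carrier ∩ A).encard := by
  rw [measurable_iff_comap_le]
  exact le_iSup₂ (f := fun (A : Set (EuclideanSpace ℝ (Fin d))) (_ : MeasurableSet A) =>
    MeasurableSpace.comap (fun Y : LocFinSet d => (Y.carrier ∩ A).encard) ⊤) A hA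

lemma measurable_ncard {A : Set (EuclideanSpace ℝ (Fin d))} (hA : MeasurableSet A) :
    Measurable fun Y : LocFinSet d => (Y.carrier ∩ A).ncard :=
  (Measurable.of_discrete (f := ENat.toNat)).comp (measurable_encard hA)

/-- The count in an unbounded set is the supremum of the counts of its intersections with centred
balls, so the counting functions of bounded Borel sets generate the σ-algebra. -/
lemma measurable_of_ncard {α : Type*} [MeasurableSpace α] {g : α → LocFinSet d}
    (hg : ∀ A : Set (EuclideanSpace ℝ (Fin d)), MeasurableSet A → Bornology.IsBounded A →
      Measurable fun a => ((g a).carrier ∩ A).ncard) : Measurable g := by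
  have key : ∀ A : Set (EuclideanSpace ℝ (Fin d)), MeasurableSet A →
      Measurable fun a => ((g a).carrier ∩ A).encard := by
    intro A hA
    have hsup : (fun a => ((g a).carrier ∩ A).encard) = fun a =>
        ⨆ n : ℕ, (((g a).carrier ∩ (A ∩ Metric.ball 0 n)).ncard : ℕ∞) := by
      funext a
      have hfin : ∀ n : ℕ, ((g a).carrier ∩ (A ∩ Metric.ball 0 n)).Finite := fun n =>
        (g a).finite_inter _ (Metric.isBounded_ball.subset Set.inter_subset_right)
      simp_rw [fun n => (hfin n).cast_ncard_eq]
      refine le_antisymm ?_ (iSup_le fun n => Set.encard_le_encard (by gcongr; simp))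
      refine ENat.forall_natCast_le_iff_le.1 fun k hk => ?_
      obtain ⟨t, ht, htk⟩ := Set.exists_subset_encard_eq hk
      have htf : t.Finite := Set.finite_of_encard_eq_coe htk
      obtain ⟨r, hr⟩ := htf.isBounded.subset_ball (0 : EuclideanSpace ℝ (Fin d))
      obtain ⟨n, hn⟩ := exists_nat_ge r
      rw [← htk]
      refine le_iSup_of_le n (Set.encard_le_encard ?_)
      exact fun x hx => ⟨(ht hx).1, (ht hx).2, Metric.ball_subset_ball hn (hr hx)⟩
    rw [hsup]
    refine measurable_to_countable' fun y => ?_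
    have hle : ∀ y : ℕ∞, MeasurableSet {a | ⨆ n : ℕ,
        (((g a).carrier ∩ (A ∩ Metric.ball 0 n)).ncard : ℕ∞) ≤ y} := by
      intro y
      simp only [iSup_le_iff, Set.ofPred_forall]
      exact MeasurableSet.iInter fun n =>
        hg _ (hA.inter measurableSet_ball) (Metric.isBounded_ball.subset Set.inter_subset_right)
          (MeasurableSet.of_discrete (s := {m : ℕ | (m : ℕ∞) ≤ y}))
    have hlt : ∀ y : ℕ∞, MeasurableSet {a | ⨆ n : ℕ,
        (((g a).carrier ∩ (A ∩ Metric.ball 0 n)).ncard : ℕ∞) < y} := by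
      intro y
      have : {a | ⨆ n : ℕ, (((g a).carrier ∩ (A ∩ Metric.ball 0 n)).ncard : ℕ∞) < y} =
          ⋃ z : {z : ℕ∞ // z < y}, {a | ⨆ n : ℕ,
            (((g a).carrier ∩ (A ∩ Metric.ball 0 n)).ncard : ℕ∞) ≤ z.1} := by
        ext a
        simp only [Set.mem_ofPred_eq, Set.mem_iUnion]
        exact ⟨fun h => ⟨⟨_, h⟩, le_rfl⟩, fun ⟨z, hz⟩ => hz.trans_lt z.2⟩
      rw [this]
      exact MeasurableSet.iUnion fun z => hle z
    convert (hle y).diff (hlt y) using 1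
    ext a
    simp only [Set.mem_preimage, Set.mem_singleton_iff, Set.mem_sdiff, Set.mem_ofPred_eq, not_lt]
    exact le_antisymm_iff
  rw [measurable_iff_comap_le]
  simp only [instMeasurableSpace, MeasurableSpace.comap_iSup, MeasurableSpace.comap_comp,
    iSup_le_iff]
  exact fun A hA => (key A hA).comap_le

lemma measurable_restrict {U : Set (EuclideanSpace ℝ (Fin d))} (hU : MeasurableSet U) :
    Measurable fun Y : LocFinSet d => Y.restrict U := by
  refine measurable_of_ncard fun A hA _ => ?_
  simp only [carrier_restrict, Set.inter_assoc]
  exact measurable_ncard (hU.inter hA)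

end LocFinSet

open LocFinSet

/-! ### Complete independence -/

section Independence

variable {d : ℕ} {Ω : Type*}

/-- The σ-algebra generated by the part of the point process `X` in `U`. -/
@[reducible]
noncomputable def sigmaOn (X : Ω → LocFinSet d) (U : Set (EuclideanSpace ℝ (Fin d))) :
    MeasurableSpace Ω :=
  MeasurableSpace.comap (fun ω => (X ω).restrict U) inferInstance

lemma sigmaOn_mono (X : Ω → LocFinSet d) {U V : Set (EuclideanSpace ℝ (Fin d))}
    (hU : MeasurableSet U) (hUV : U ⊆ V) : sigmaOn X U ≤ sigmaOn X V := by
  have h : (fun ω => (X ω).restrict U) = (fun Y => Y.restrict U) ∘ fun ω => (X ω).restrict V := by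
    funext ω
    simp [restrict_restrict, Set.inter_eq_right.2 hUV]
  rw [sigmaOn, h, ← MeasurableSpace.comap_comp]
  exact MeasurableSpace.comap_mono (measurable_restrict hU).comap_le

lemma sigmaOn_empty (X : Ω → LocFinSet d) : sigmaOn X ∅ = ⊥ := by
  simp [sigmaOn, restrict_empty, MeasurableSpace.comap_const]

lemma sigmaOn_univ (X : Ω → LocFinSet d) :
    sigmaOn X Set.univ = MeasurableSpace.comap X inferInstance := by
  simp [sigmaOn, restrict_univ]

lemma sigmaOn_le_iff {X : Ω → LocFinSet d} {U : Set (EuclideanSpace ℝ (Fin d))}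
    (hU : MeasurableSet U) {m : MeasurableSpace Ω} :
    sigmaOn X U ≤ m ↔ ∀ A : Set (EuclideanSpace ℝ (Fin d)), MeasurableSet A →
      Bornology.IsBounded A → A ⊆ U → Measurable[m] fun ω => ((X ω).carrier ∩ A).ncard := by
  constructor
  · intro h A hA _ hAU
    have : (fun ω => ((X ω).carrier ∩ A).ncard) =
        (fun Y : LocFinSet d => (Y.carrier ∩ A).ncard) ∘ fun ω => (X ω).restrict U := by
      funext ω
      simp [carrier_restrict, Set.inter_assoc, Set.inter_eq_right.2 hAU]
    rw [this]
    exact (measurable_ncard hA).comp (measurable_iff_comap_le.2 h)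
  · intro h
    refine measurable_iff_comap_le.1 (measurable_of_ncard fun A hA hAb => ?_)
    simp only [carrier_restrict, Set.inter_assoc]
    exact h _ (hU.inter hA) (hAb.subset Set.inter_subset_right) Set.inter_subset_left

lemma measurable_comp_restrict (X : Ω → LocFinSet d) (U : Set (EuclideanSpace ℝ (Fin d)))
    {S : LocFinSet d → ℝ} (hS : Measurable S) :
    Measurable[sigmaOn X U] fun ω => S ((X ω).restrict U) :=
  hS.comp (comap_measurable _)

lemma sigmaOn_union_le (X : Ω → LocFinSet d) {U V : Set (EuclideanSpace ℝ (Fin d))}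
    (hU : MeasurableSet U) (hV : MeasurableSet V) (hd : Disjoint U V) :
    sigmaOn X (U ∪ V) ≤ sigmaOn X U ⊔ sigmaOn X V := by
  refine (sigmaOn_le_iff (hU.union hV)).2 fun A hA hAb hAUV => ?_
  have hsplit : (fun ω => ((X ω).carrier ∩ A).ncard) = fun ω =>
      ((X ω).carrier ∩ (A ∩ U)).ncard + ((X ω).carrier ∩ (A ∩ V)).ncard := by
    funext ω
    have hf := (X ω).finite_inter A hAb
    rw [← Set.ncard_union_eq ?_ (hf.subset (by gcongr; simp)) (hf.subset (by gcongr; simp)),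
      ← Set.inter_union_distrib_left, ← Set.inter_union_distrib_left, Set.inter_eq_left.2 hAUV]
    exact hd.mono (by rw [← Set.inter_assoc]; exact Set.inter_subset_right)
      (by rw [← Set.inter_assoc]; exact Set.inter_subset_right)
  rw [hsplit]
  have h1 := (sigmaOn_le_iff (X := X) hU).1 (le_sup_left (b := sigmaOn X V)) (A ∩ U) (hA.inter hU)
    (hAb.subset Set.inter_subset_left) Set.inter_subset_right
  have h2 := (sigmaOn_le_iff (X := X) hV).1 (le_sup_right (a := sigmaOn X U)) (A ∩ V)
    (hA.inter hV) (hAb.subset Set.inter_subset_left) Set.inter_subset_right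
  exact Measurable.add h1 h2

variable [mΩ : MeasurableSpace Ω] {P : Measure Ω} {γ : ℝ≥0} {X : Ω → LocFinSet d}

lemma sigmaOn_le (hX : Measurable X) {U : Set (EuclideanSpace ℝ (Fin d))}
    (hU : MeasurableSet U) : sigmaOn X U ≤ mΩ :=
  ((measurable_restrict hU).comp hX).comap_le

/-- The σ-algebra generated by the counts of the sets `A ∩ B`, `A ∈ D`. -/
@[reducible]
noncomputable def countSigma (X : Ω → LocFinSet d) (B : Set (EuclideanSpace ℝ (Fin d)))
    (D : Finset (Set (EuclideanSpace ℝ (Fin d)))) : MeasurableSpace Ω :=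
  ⨆ A ∈ D, MeasurableSpace.comap (fun ω => ((X ω).carrier ∩ (A ∩ B)).ncard) inferInstance

open Classical in
/-- Refining the sets of `D` into the atoms of the Boolean algebra they generate makes the counts
inside `B` and outside `B` functions of disjoint families of independent variables. -/
lemma indep_countSigma [IsProbabilityMeasure P] (hX : IsPoissonPointProcess P γ X)
    {B : Set (EuclideanSpace ℝ (Fin d))} (hB : MeasurableSet B)
    (D : Finset (Set (EuclideanSpace ℝ (Fin d))))
    (hD : ∀ A ∈ D, MeasurableSet A ∧ Bornology.IsBounded A) :
    Indep (countSigma X B D) (countSigma X Bᶜ D) P := by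
  -- `a x` records which sets of `D` contain `x`; its fibres are the atoms.
  let a : EuclideanSpace ℝ (Fin d) → Finset (Set (EuclideanSpace ℝ (Fin d))) :=
    fun x => D.filter (fun A => x ∈ A)
  have ha : ∀ t, MeasurableSet (a ⁻¹' {t}) := by
    intro t
    by_cases ht : t ⊆ D
    · have : a ⁻¹' {t} = ⋂ A ∈ D, if A ∈ t then A else Aᶜ := by
        ext x
        simp only [Set.mem_preimage, Set.mem_singleton_iff, a, Finset.ext_iff, Finset.mem_filter,
          Set.mem_iInter]
        constructor
        · intro h A hA
          split_ifs with hAt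
          · exact ((h A).2 hAt).2
          · exact fun hx => hAt ((h A).1 ⟨hA, hx⟩)
        · intro h A
          constructor
          · rintro ⟨hA, hx⟩
            by_contra hAt
            have := h A hA
            rw [if_neg hAt] at this
            exact this hx
          · intro hAt
            have := h A (ht hAt)
            rw [if_pos hAt] at this
            exact ⟨ht hAt, this⟩
      rw [this]
      refine Finset.measurableSet_biInter _ fun A hA => ?_
      split_ifs
      · exact (hD A hA).1
      · exact (hD A hA).1.compl
    · convert MeasurableSet.empty
      ext x
      simp only [Set.mem_preimage, Set.mem_singleton_iff, Set.mem_empty_iff_false, iff_false]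
      rintro rfl
      exact ht (Finset.filter_subset _ _)
  let side : Bool → Set (EuclideanSpace ℝ (Fin d)) := fun b => if b then B else Bᶜ
  have hside : ∀ b, MeasurableSet (side b) := by
    intro b; cases b
    · exact hB.compl
    · exact hB
  let ι := {t : Finset (Set (EuclideanSpace ℝ (Fin d))) // t ∈ D.powerset ∧ t.Nonempty} × Bool
  have : Finite {t : Finset (Set (EuclideanSpace ℝ (Fin d))) // t ∈ D.powerset ∧ t.Nonempty} :=
    Set.Finite.to_subtype (D.powerset.finite_toSet.subset fun t ht => ht.1)
  let C : ι → Set (EuclideanSpace ℝ (Fin d)) := fun p => a ⁻¹' {p.1.1} ∩ side p.2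
  have hCm : ∀ p, MeasurableSet (C p) := fun p => (ha _).inter (hside _)
  have hatom : ∀ t : Finset (Set (EuclideanSpace ℝ (Fin d))), ∀ A ∈ t, a ⁻¹' {t} ⊆ A := by
    intro t A hA x hx
    rw [Set.mem_preimage, Set.mem_singleton_iff] at hx
    rw [← hx] at hA
    exact (Finset.mem_filter.1 hA).2
  have hCb : ∀ p, Bornology.IsBounded (C p) := by
    rintro ⟨⟨t, htD, A, hA⟩, b⟩
    exact (hD A (Finset.mem_powerset.1 htD hA)).2.subset
      (Set.inter_subset_left.trans (hatom t A hA))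
  have hCd : Pairwise fun p q => Disjoint (C p) (C q) := by
    rintro ⟨⟨t, ht⟩, b⟩ ⟨⟨s, hs⟩, c⟩ hne
    rw [Set.disjoint_left]
    rintro x ⟨hx1, hx2⟩ ⟨hx3, hx4⟩
    apply hne
    have hts : t = s := by
      simp only [Set.mem_preimage, Set.mem_singleton_iff] at hx1 hx3
      rw [← hx1, ← hx3]
    subst hts
    have hbc : b = c := by
      cases b <;> cases c <;> simp_all [side]
    subst hbc
    rfl
  have hind : iIndepFun (fun (p : ι) (ω : Ω) => ((X ω).carrier ∩ C p).ncard) P := by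
    obtain ⟨n, ⟨e⟩⟩ := Finite.exists_equiv_fin ι
    have h := hX.indep_count n (fun i => C (e.symm i)) (fun i => hCm _) (fun i => hCb _)
      (fun i j hij => hCd (e.symm.injective.ne hij))
    exact (iIndepFun_precomp_of_bijective e.symm.bijective
      (f := fun (p : ι) (ω : Ω) => ((X ω).carrier ∩ C p).ncard)).1 h
  have hdisj : Disjoint {p : ι | p.2 = true} {p : ι | p.2 = false} := by
    rw [Set.disjoint_left]
    rintro ⟨t, b⟩ h1 h2
    simp_all
  have hindep := indep_iSup_of_disjoint
    (fun p => ((measurable_ncard (hCm p)).comp hX.measurable).comap_le) hind.iIndep hdisj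
  have hle : ∀ b, countSigma X (side b) D ≤ ⨆ p ∈ {p : ι | p.2 = b},
      MeasurableSpace.comap (fun ω => ((X ω).carrier ∩ C p).ncard) inferInstance := by
    intro b
    refine iSup₂_le fun A hA => ?_
    rw [← measurable_iff_comap_le]
    have hsum : (fun ω => ((X ω).carrier ∩ (A ∩ side b)).ncard) = fun ω =>
        ∑ t ∈ D.powerset with A ∈ t, ((X ω).carrier ∩ (a ⁻¹' {t} ∩ side b)).ncard := by
      funext ω
      have hcov : (X ω).carrier ∩ (A ∩ side b) = ⋃ t ∈ (D.powerset.filter (A ∈ ·)),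
          (X ω).carrier ∩ (a ⁻¹' {t} ∩ side b) := by
        ext x
        simp only [Set.mem_inter_iff, Set.mem_iUnion, Finset.mem_filter, Finset.mem_powerset,
          exists_prop]
        constructor
        · rintro ⟨hx, hxA, hxb⟩
          exact ⟨a x, ⟨Finset.filter_subset _ _, Finset.mem_filter.2 ⟨hA, hxA⟩⟩, hx, rfl, hxb⟩
        · rintro ⟨t, ⟨_, hAt⟩, hx, hxt, hxb⟩
          exact ⟨hx, hatom t A hAt hxt, hxb⟩
      rw [hcov, ← finsum_mem_coe_finset]
      refine Set.Finite.ncard_biUnion (Finset.finite_toSet _) (fun t ht => ?_)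
        fun t _ s _ hts => ?_
      · exact (X ω).finite_inter _ ((hD A hA).2.subset
          (Set.inter_subset_left.trans (hatom t A (Finset.mem_filter.1 ht).2)))
      · rw [Function.onFun, Set.disjoint_left]
        rintro x ⟨_, hxt, _⟩ ⟨_, hxs, _⟩
        exact hts (Eq.trans (Eq.symm hxt) hxs)
    rw [hsum]
    refine Finset.measurable_sum _ fun t ht => ?_
    rw [Finset.mem_filter] at ht
    refine measurable_iff_comap_le.2 (le_iSup₂_of_le (⟨⟨t, ht.1, A, ht.2⟩, b⟩ : ι) rfl le_rfl)
  exact indep_of_indep_of_le_left (indep_of_indep_of_le_right hindep (hle false)) (hle true)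

open Classical in
/-- Complete independence of a Poisson process, from that of finitely many bounded sets: both
σ-algebras are directed suprema of the `countSigma X _ D`. -/
lemma IsPoissonPointProcess.indep_sigmaOn [IsProbabilityMeasure P]
    (hX : IsPoissonPointProcess P γ X) {B : Set (EuclideanSpace ℝ (Fin d))}
    (hB : MeasurableSet B) : Indep (sigmaOn X B) (sigmaOn X Bᶜ) P := by
  let J := {D : Finset (Set (EuclideanSpace ℝ (Fin d))) //
    ∀ A ∈ D, MeasurableSet A ∧ Bornology.IsBounded A}
  have hunion : ∀ D E : J, ∀ A ∈ D.1 ∪ E.1, MeasurableSet A ∧ Bornology.IsBounded A :=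
    fun D E A hA => (Finset.mem_union.1 hA).elim (D.2 A) (E.2 A)
  have hmono : ∀ (U : Set (EuclideanSpace ℝ (Fin d))) {D E}, D ⊆ E →
      countSigma X U D ≤ countSigma X U E := fun U D E h =>
    biSup_mono fun A hA => h hA
  have hle : ∀ U : Set (EuclideanSpace ℝ (Fin d)), MeasurableSet U → ∀ D : J,
      countSigma X U D.1 ≤ mΩ := fun U hU D => iSup₂_le fun A hA =>
    ((measurable_ncard ((D.2 A hA).1.inter hU)).comp hX.measurable).comap_le
  have hdir : ∀ U : Set (EuclideanSpace ℝ (Fin d)),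
      Directed (· ≤ ·) fun D : J => countSigma X U D.1 := fun U D E =>
    ⟨⟨D.1 ∪ E.1, hunion D E⟩, hmono U Finset.subset_union_left, hmono U Finset.subset_union_right⟩
  have hpair : ∀ D E : J, Indep (countSigma X B D.1) (countSigma X Bᶜ E.1) P := fun D E =>
    indep_of_indep_of_le_left (indep_of_indep_of_le_right
      (indep_countSigma hX hB (D.1 ∪ E.1) (hunion D E)) (hmono _ Finset.subset_union_right))
      (hmono _ Finset.subset_union_left)
  have hgen : ∀ U : Set (EuclideanSpace ℝ (Fin d)), MeasurableSet U →
      sigmaOn X U ≤ ⨆ D : J, countSigma X U D.1 := by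
    intro U hU
    refine (sigmaOn_le_iff hU).2 fun A hA hAb hAU => measurable_iff_comap_le.2 ?_
    refine le_iSup_of_le (⟨{A}, by simpa using ⟨hA, hAb⟩⟩ : J) ?_
    simp [countSigma, Set.inter_eq_left.2 hAU]
  have h1 : ∀ E : J, Indep (⨆ D : J, countSigma X B D.1) (countSigma X Bᶜ E.1) P := fun E =>
    indep_iSup_of_directed_le (fun D => hpair D E) (hle B hB) (hle _ hB.compl E) (hdir B)
  have h2 := indep_iSup_of_directed_le (fun E => (h1 E).symm) (hle _ hB.compl)
    (iSup_le (hle B hB)) (hdir Bᶜ)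
  exact indep_of_indep_of_le_left (indep_of_indep_of_le_right h2.symm (hgen _ hB.compl))
    (hgen _ hB)

end Independence

/-! ### Conditional expectations and variances -/

section CondExp

variable {Ω : Type*} {m₁ m₂ m h mΩ : MeasurableSpace Ω} {P : Measure Ω}

/-- Enlarging the conditioning σ-algebra `m₁` by information `h` independent of both the variable
and `m₁` does not change the conditional expectation. -/
lemma condExp_sup_of_indep [IsProbabilityMeasure P] {G : Ω → ℝ} (h₁₂ : m₁ ≤ m₂) (h₂ : m₂ ≤ mΩ)
    (hh : h ≤ mΩ) (hG : StronglyMeasurable[m₂] G) (hGi : Integrable G P) (hind : Indep h m₂ P) :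
    P[G | m₁ ⊔ h] =ᵐ[P] P[G | m₁] := by
  have h₁ : m₁ ≤ mΩ := h₁₂.trans h₂
  have hsup : m₁ ⊔ h ≤ mΩ := sup_le h₁ hh
  have hmeas : StronglyMeasurable[m₁ ⊔ h] (P[G | m₁]) :=
    stronglyMeasurable_condExp.mono le_sup_left
  symm
  refine ae_eq_condExp_of_forall_setIntegral_eq hsup hGi
    (fun _ _ _ => integrable_condExp.integrableOn) ?_ hmeas.aestronglyMeasurable
  -- For `K` measurable with respect to `m₂`, integrals over `A ∩ H` factorize.
  have hfac : ∀ K : Ω → ℝ, StronglyMeasurable[m₂] K → Integrable K P →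
      ∀ A H, MeasurableSet[m₁] A → MeasurableSet[h] H →
        ∫ ω in A ∩ H, K ω ∂P = P.real H * ∫ ω in A, K ω ∂P := by
    intro K hK hKi A H hA hH
    have hAK : StronglyMeasurable[m₂] (A.indicator K) := hK.indicator (h₁₂ _ hA)
    have hAKi : Integrable (A.indicator K) P := hKi.indicator (h₁ _ hA)
    have hce := condExp_indep_eq h₂ hh hAK hind.symm
    rw [Set.inter_comm, ← setIntegral_indicator (h₁ _ hA), ← setIntegral_condExp hh hAKi hH,
      setIntegral_congr_ae (hh _ hH) (hce.mono fun ω hω _ => hω), setIntegral_const,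
      integral_indicator (h₁ _ hA), smul_eq_mul]
  intro s hs _
  have hgen : m₁ ⊔ h = MeasurableSpace.generateFrom
      (Set.image2 (· ∩ ·) {A | MeasurableSet[m₁] A} {H | MeasurableSet[h] H}) := by
    refine le_antisymm (sup_le (fun A hA => ?_) fun H hH => ?_)
      (MeasurableSpace.generateFrom_le ?_)
    · exact MeasurableSpace.measurableSet_generateFrom ⟨A, hA, Set.univ, .univ, Set.inter_univ A⟩
    · exact MeasurableSpace.measurableSet_generateFrom ⟨Set.univ, .univ, H, hH, Set.univ_inter H⟩
    · rintro _ ⟨A, hA, H, hH, rfl⟩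
      exact MeasurableSet.inter (le_sup_left (a := m₁) _ hA) (le_sup_right (b := h) _ hH)
  have hpi : IsPiSystem
      (Set.image2 (· ∩ ·) {A | MeasurableSet[m₁] A} {H | MeasurableSet[h] H}) := by
    rintro _ ⟨A, hA, H, hH, rfl⟩ _ ⟨A', hA', H', hH', rfl⟩ _
    exact ⟨A ∩ A', hA.inter hA', H ∩ H', hH.inter hH', Set.inter_inter_inter_comm ..⟩
  have hci : Integrable (P[G | m₁]) P := integrable_condExp
  induction s, hs using MeasurableSpace.induction_on_inter hgen hpi with
  | empty => simp
  | basic s hs =>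
    obtain ⟨A, hA, H, hH, rfl⟩ := hs
    rw [hfac _ (stronglyMeasurable_condExp.mono h₁₂) hci A H hA hH, hfac G hG hGi A H hA hH,
      setIntegral_condExp h₁ hGi hA]
  | compl s hs ih =>
    have e1 := integral_add_compl (hsup _ hs) hci
    have e2 := integral_add_compl (hsup _ hs) hGi
    have e3 := integral_condExp (f := G) (μ := P) h₁
    have := ih (measure_lt_top _ _)
    linarith
  | iUnion f hd hf ih =>
    rw [integral_iUnion (fun i => hsup _ (hf i)) hd hci.integrableOn,
      integral_iUnion (fun i => hsup _ (hf i)) hd hGi.integrableOn]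
    exact tsum_congr fun i => ih i (measure_lt_top _ _)

/-- Pythagoras for conditional expectations: by the tower property, the gain in variance from
`m₁` to `m₂` is the mean square of the increment. -/
lemma variance_condExp_sub_variance_condExp [IsProbabilityMeasure P] {F : Ω → ℝ} (h₁₂ : m₁ ≤ m₂)
    (h₂ : m₂ ≤ mΩ) (hF : MemLp F 2 P) :
    Var[P[F | m₂]; P] - Var[P[F | m₁]; P] = ∫ ω, ((P[F | m₂]) ω - (P[F | m₁]) ω) ^ 2 ∂P := by
  have hF2 : MemLp (P[F | m₂]) 2 P := hF.condExp one_le_two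
  have htower : P[P[F | m₂] | m₁] =ᵐ[P] P[F | m₁] := condExp_condExp_of_le h₁₂ h₂
  have htot := integral_condVar_add_variance_condExp (h₁₂.trans h₂) hF2
  rw [variance_congr htower, condVar, integral_condExp (h₁₂.trans h₂)] at htot
  rw [← htot, add_sub_cancel_right]
  refine integral_congr_ae ?_
  filter_upwards [htower] with ω hω
  simp [hω]

lemma variance_condExp_le [IsProbabilityMeasure P] {F : Ω → ℝ} (hm : m ≤ mΩ) (hF : MemLp F 2 P) :
    Var[P[F | m]; P] ≤ Var[F; P] := by
  rw [← integral_condVar_add_variance_condExp hm hF]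
  refine le_add_of_nonneg_left (integral_nonneg_of_ae ?_)
  exact condExp_nonneg (.of_forall fun ω => sq_nonneg _)

/-- The variance gained by refining `m₁` to `m₂` only depends on `F` up to a variable `G` whose
conditional expectation is the same given `m₁` and given `m₂`. -/
lemma variance_condExp_le_add [IsProbabilityMeasure P] {F G : Ω → ℝ} (h₁₂ : m₁ ≤ m₂)
    (h₂ : m₂ ≤ mΩ) (hF : MemLp F 2 P) (hG : MemLp G 2 P) (h : P[G | m₂] =ᵐ[P] P[G | m₁]) :
    Var[P[F | m₂]; P] ≤ Var[P[F | m₁]; P] + ∫ ω, (F ω - G ω) ^ 2 ∂P := by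
  have hFG : MemLp (F - G) 2 P := hF.sub hG
  have eF := variance_condExp_sub_variance_condExp h₁₂ h₂ hF
  have eFG := variance_condExp_sub_variance_condExp h₁₂ h₂ hFG
  have hcongr : ∫ ω, ((P[F | m₂]) ω - (P[F | m₁]) ω) ^ 2 ∂P =
      ∫ ω, ((P[F - G | m₂]) ω - (P[F - G | m₁]) ω) ^ 2 ∂P := by
    refine integral_congr_ae ?_
    have hFi := hF.integrable one_le_two
    have hGi := hG.integrable one_le_two
    filter_upwards [condExp_sub hFi hGi m₁, condExp_sub hFi hGi m₂, h] with ω h1 h2 h3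
    rw [h1, h2, Pi.sub_apply, Pi.sub_apply, h3]
    ring
  have hle := (variance_condExp_le h₂ hFG).trans (variance_le_expectation_sq hFG.1)
  have hnn := variance_nonneg (P[F - G | m₁]) P
  simp only [Pi.pow_apply, Pi.sub_apply] at hle
  linarith

end CondExp

/-! ### Emptying cells and deleting points -/

section Deletion

variable {d : ℕ}

namespace LocFinSet

lemma restrict_compl_eq_erase {Y : LocFinSet d} {B : Set (EuclideanSpace ℝ (Fin d))}
    {x : EuclideanSpace ℝ (Fin d)} (h : Y.carrier ∩ B = {x}) : Y.restrict Bᶜ = Y.erase x := by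
  ext1
  change Y.carrier ∩ Bᶜ = Y.carrier \ {x}
  rw [← h, Set.sdiff_self_inter, Set.sdiff_eq]

lemma restrict_compl_eq_self {Y : LocFinSet d} {B : Set (EuclideanSpace ℝ (Fin d))}
    (h : Y.carrier ∩ B = ∅) : Y.restrict Bᶜ = Y := by
  ext1
  rw [carrier_restrict, Set.inter_eq_left]
  exact fun x hx hxB => (h.subset ⟨hx, hxB⟩)

/-- The sum over the points of `Y` dominates the contributions of the cells with one point:
emptying a cell which holds exactly one point deletes that point. -/
lemma sum_cells_le_tsum_erase (S : LocFinSet d → ℝ) (Y : LocFinSet d)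
    {B : ℕ → Set (EuclideanSpace ℝ (Fin d))} (hB : Pairwise fun i j => Disjoint (B i) (B j))
    (N : ℕ) :
    ∑ i ∈ Finset.range N, {Y : LocFinSet d | (Y.carrier ∩ B i).ncard = 1}.indicator
        (fun Y => ENNReal.ofReal ((S (Y.restrict (B i)ᶜ) - S Y) ^ 2)) Y ≤
      ∑' x : Y.carrier, ENNReal.ofReal
        ((S (Y.erase (x : EuclideanSpace ℝ (Fin d))) - S Y) ^ 2) := by
  classical
  simp only [Set.indicator_apply, Set.mem_ofPred_eq, ← Finset.sum_filter]
  set I := (Finset.range N).filter fun i => (Y.carrier ∩ B i).ncard = 1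
  have hI : ∀ i : I, ∃ x, Y.carrier ∩ B i = {x} := fun i =>
    Set.ncard_eq_one.1 (Finset.mem_filter.1 i.2).2
  choose x hx using hI
  have hxm : ∀ i : I, x i ∈ Y.carrier ∩ B i := fun i => by rw [hx i]; rfl
  let φ : I → Y.carrier := fun i => ⟨x i, (hxm i).1⟩
  have hφ : Function.Injective φ := by
    intro i j hij
    have hxy : x i = x j := congrArg Subtype.val hij
    by_contra hne
    exact Set.disjoint_left.1 (hB fun h => hne (Subtype.ext h)) (hxm i).2 (hxy ▸ (hxm j).2)
  rw [← Finset.sum_coe_sort I, ← tsum_fintype (L := .unconditional _)]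
  refine le_trans (le_of_eq (tsum_congr fun i => ?_))
    (ENNReal.tsum_comp_le_tsum_of_injective hφ fun x : Y.carrier => ENNReal.ofReal
      ((S (Y.erase (x : EuclideanSpace ℝ (Fin d))) - S Y) ^ 2))
  rw [restrict_compl_eq_erase (hx i)]

end LocFinSet

end Deletion

/-! ### The Efron–Stein inequality -/

section EfronStein

variable {d : ℕ} {Ω : Type*} [mΩ : MeasurableSpace Ω] {P : Measure Ω} {γ : ℝ≥0}
  {X : Ω → LocFinSet d}

/-- Efron–Stein inequality for the independent restrictions of a Poisson process to disjoint
cells. The cells are revealed one after the other; the functional evaluated with the cell `B i`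
emptied does not depend on what cell `i` reveals, so it may be subtracted in the `i`-th step. -/
lemma IsPoissonPointProcess.variance_condExp_le_sum [IsProbabilityMeasure P]
    (hX : IsPoissonPointProcess P γ X) {S : LocFinSet d → ℝ} (hS : Measurable S) {M : ℝ}
    (hM : ∀ Y, |S Y| ≤ M) {B : ℕ → Set (EuclideanSpace ℝ (Fin d))}
    (hBm : ∀ i, MeasurableSet (B i)) (hBd : Pairwise fun i j => Disjoint (B i) (B j)) (N : ℕ) :
    Var[P[fun ω => S (X ω) | sigmaOn X (⋃ i, ⋃ (_ : i < N), B i)]; P] ≤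
      ∑ i ∈ Finset.range N, ∫ ω, (S (X ω) - S ((X ω).restrict (B i)ᶜ)) ^ 2 ∂P := by
  have hU : ∀ n, MeasurableSet (⋃ i, ⋃ (_ : i < n), B i) := fun n =>
    MeasurableSet.iUnion fun i => MeasurableSet.iUnion fun _ => hBm i
  have hL2 : ∀ T : LocFinSet d → LocFinSet d, Measurable T →
      MemLp (fun ω => S (T (X ω))) 2 P := fun T hT =>
    MemLp.of_bound ((hS.comp hT).comp hX.measurable).aestronglyMeasurable M
      (.of_forall fun ω => hM _)
  induction N with
  | zero =>
    have h0 : (⋃ i, ⋃ (_ : i < 0), B i) = ∅ := by simp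
    rw [h0, sigmaOn_empty, condExp_bot]
    simp [variance_eq_integral aemeasurable_const]
  | succ N ih =>
    have hdisj : Disjoint (⋃ i, ⋃ (_ : i < N), B i) (B N) := by
      simp only [Set.disjoint_iUnion_left]
      exact fun i hi => hBd hi.ne
    rw [Finset.sum_range_succ, Set.biUnion_lt_succ]
    have hUN := (hU N).union (hBm N)
    have h₁₂ := sigmaOn_mono X (hU N) (Set.subset_union_left (t := B N))
    have h₂ := sigmaOn_le hX.measurable hUN
    have hG := hL2 _ (measurable_restrict (hBm N).compl)
    have hsub : sigmaOn X (⋃ i, ⋃ (_ : i < N), B i) ≤ sigmaOn X (B N)ᶜ :=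
      sigmaOn_mono X (hU N) hdisj.subset_compl_right
    have hGc : P[fun ω => S ((X ω).restrict (B N)ᶜ) |
        sigmaOn X (⋃ i, ⋃ (_ : i < N), B i) ⊔ sigmaOn X (B N)] =ᵐ[P]
        P[fun ω => S ((X ω).restrict (B N)ᶜ) | sigmaOn X (⋃ i, ⋃ (_ : i < N), B i)] :=
      condExp_sup_of_indep hsub (sigmaOn_le hX.measurable (hBm N).compl)
        (sigmaOn_le hX.measurable (hBm N))
        (measurable_comp_restrict X _ hS).stronglyMeasurable (hG.integrable one_le_two)
        (hX.indep_sigmaOn (hBm N))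
    have heq : sigmaOn X (⋃ i, ⋃ (_ : i < N), B i) ⊔ sigmaOn X (B N) =
        sigmaOn X ((⋃ i, ⋃ (_ : i < N), B i) ∪ B N) :=
      le_antisymm (sup_le h₁₂ (sigmaOn_mono X (hBm N) Set.subset_union_right))
        (sigmaOn_union_le X (hU N) (hBm N) hdisj)
    rw [heq] at hGc
    -- `G = S (X ∖ B N)` has the same conditional expectation before and after revealing `B N`.
    have hstep := variance_condExp_le_add h₁₂ h₂ (hL2 id measurable_id) hG hGc
    exact hstep.trans (by simpa using ih)

end EfronStein

/-! ### Poisson counts -/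

section PoissonCounts

variable {d : ℕ} {Ω : Type*} [mΩ : MeasurableSpace Ω] {P : Measure Ω} {γ : ℝ≥0}
  {X : Ω → LocFinSet d}

lemma poissonMeasure_two_le (r : ℝ≥0) : poissonMeasure r {n | 2 ≤ n} ≤ (r : ℝ≥0∞) ^ 2 := by
  have hcompl : {n : ℕ | 2 ≤ n} = ({0} ∪ {1} : Set ℕ)ᶜ := by
    ext n
    simp only [Set.mem_ofPred_eq, Set.mem_compl_iff, Set.mem_union, Set.mem_singleton_iff]
    lia
  rw [hcompl, prob_compl_eq_one_sub (by measurability), measure_union (by simp) (by simp),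
    poissonMeasure_singleton, poissonMeasure_singleton,
    ← ENNReal.ofReal_add (by positivity) (by positivity), ← ENNReal.ofReal_one,
    ← ENNReal.ofReal_sub _ (by positivity)]
  have h := Real.one_sub_le_exp_neg (r : ℝ)
  refine (ENNReal.ofReal_le_ofReal (q := (r : ℝ) ^ 2) ?_).trans ?_
  · simp only [pow_zero, Nat.factorial, Nat.cast_one, pow_one]
    have hr : (0 : ℝ) ≤ r := r.2
    norm_num
    nlinarith
  · rw [ENNReal.ofReal_pow r.coe_nonneg, ENNReal.ofReal_coe_nnreal]

lemma IsPoissonPointProcess.measurable_ncard (hX : IsPoissonPointProcess P γ X)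
    {B : Set (EuclideanSpace ℝ (Fin d))} (hB : MeasurableSet B) :
    Measurable fun ω => ((X ω).carrier ∩ B).ncard :=
  (LocFinSet.measurable_ncard hB).comp hX.measurable

lemma IsPoissonPointProcess.measure_two_le (hX : IsPoissonPointProcess P γ X)
    {B : Set (EuclideanSpace ℝ (Fin d))} (hB : MeasurableSet B) (hBb : Bornology.IsBounded B) :
    P {ω | 2 ≤ ((X ω).carrier ∩ B).ncard} ≤ (γ * volume B) ^ 2 := by
  have h := poissonMeasure_two_le (γ * (volume B).toNNReal)
  rw [← hX.map_count B hB hBb,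
    Measure.map_apply (hX.measurable_ncard hB) (by measurability),
    ENNReal.coe_mul, ENNReal.coe_toNNReal hBb.measure_lt_top.ne] at h
  exact h

/-- In dimension `0` there is no Poisson process: a subset of a point never has two points. -/
lemma IsPoissonPointProcess.dim_ne_zero (hX : IsPoissonPointProcess P γ X) (hγ : 0 < γ) :
    d ≠ 0 := by
  rintro rfl
  have hb : Bornology.IsBounded (Set.univ : Set (EuclideanSpace ℝ (Fin 0))) :=
    Set.subsingleton_univ.finite.isBounded
  have h := congrArg (fun μ => μ {2}) (hX.map_count Set.univ .univ hb)
  simp only [Measure.map_apply (hX.measurable_ncard .univ)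
    (measurableSet_singleton 2), poissonMeasure_singleton] at h
  have hempty : (fun ω => ((X ω).carrier ∩ Set.univ).ncard) ⁻¹' {2} = ∅ := by
    refine Set.eq_empty_iff_forall_notMem.2 fun ω hω => ?_
    have h1 : ((X ω).carrier ∩ Set.univ).ncard ≤ 1 := (Set.ncard_le_one
      ((X ω).finite_inter _ hb)).2 fun _ _ _ _ => Subsingleton.elim _ _
    simp only [Set.mem_preimage, Set.mem_singleton_iff] at hω
    lia
  rw [hempty, measure_empty, eq_comm, ENNReal.ofReal_eq_zero] at h
  have hv : 0 < (volume (Set.univ : Set (EuclideanSpace ℝ (Fin 0)))).toNNReal :=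
    ENNReal.toNNReal_pos (isOpen_univ.measure_ne_zero _ Set.univ_nonempty) hb.measure_lt_top.ne
  have : (0 : ℝ) < (γ * (volume (Set.univ : Set (EuclideanSpace ℝ (Fin 0)))).toNNReal : ℝ≥0) :=
    NNReal.coe_pos.2 (mul_pos hγ hv)
  exact absurd h (not_le.2 (by positivity))

end PoissonCounts

/-! ### Partitions into small cells -/

section Cells

variable {d : ℕ}

/-- A bounded Borel set splits into finitely many disjoint cells, each contained in a ball of
radius `ε`; smallness is stated for the volumes. -/
lemma exists_small_cells {W : Set (EuclideanSpace ℝ (Fin d))} (hW : MeasurableSet W)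
    (hWb : Bornology.IsBounded W) {ε : ℝ} (hε : 0 < ε) :
    ∃ (B : ℕ → Set (EuclideanSpace ℝ (Fin d))) (N : ℕ), (∀ i, MeasurableSet (B i)) ∧
      (Pairwise fun i j => Disjoint (B i) (B j)) ∧
      (∀ i, volume (B i) ≤ volume (Metric.ball (0 : EuclideanSpace ℝ (Fin d)) ε)) ∧
      (⋃ i, ⋃ (_ : i < N), B i) = W := by
  let f : ℕ → Set (EuclideanSpace ℝ (Fin d)) := fun i =>
    Metric.ball (TopologicalSpace.denseSeq (EuclideanSpace ℝ (Fin d)) i) ε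
  have hcov : closure W ⊆ ⋃ n, ⋃ i ≤ n, f i := by
    intro x _
    obtain ⟨i, hi⟩ := (TopologicalSpace.denseRange_denseSeq _).exists_dist_lt x hε
    exact Set.mem_iUnion.2 ⟨i, Set.mem_iUnion₂.2 ⟨i, le_rfl, hi⟩⟩
  obtain ⟨n, hn⟩ := hWb.isCompact_closure.elim_directed_cover (fun n => ⋃ i ≤ n, f i)
    (fun n => isOpen_biUnion fun i _ => Metric.isOpen_ball) hcov
    (directed_of_isDirected_le fun m n hmn =>
      Set.biUnion_subset_biUnion_left fun i hi => le_trans hi hmn)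
  refine ⟨fun i => W ∩ disjointed f i, n + 1,
    fun i => hW.inter (.disjointed (fun i => measurableSet_ball) i), fun i j hij =>
      (disjoint_disjointed f hij).mono Set.inter_subset_right Set.inter_subset_right,
    fun i => ?_, ?_⟩
  · refine (measure_mono (Set.inter_subset_right.trans (disjointed_le f i))).trans ?_
    exact (Measure.addHaar_ball_center volume _ ε).le
  · have h := biUnion_range_succ_disjointed f n
    simp only [Finset.mem_range, partialSups_eq_biUnion_range, Nat.lt_succ_iff] at h
    simp only [Nat.lt_succ_iff, ← Set.inter_iUnion]
    rw [h, Set.inter_eq_left]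
    exact subset_closure.trans hn

lemma tendsto_volume_ball_zero (hd : d ≠ 0) :
    Tendsto (fun n : ℕ => volume (Metric.ball (0 : EuclideanSpace ℝ (Fin d)) (1 / (n + 1))))
      atTop (𝓝 0) := by
  have : Nonempty (Fin d) := Fin.pos_iff_nonempty.1 (Nat.pos_of_ne_zero hd)
  have h1 : Tendsto (fun n : ℕ => ENNReal.ofReal (1 / ((n : ℝ) + 1)) ^ d) atTop (𝓝 0) := by
    have h2 := ((ENNReal.continuous_pow d).tendsto _).comp
      (ENNReal.tendsto_ofReal (tendsto_one_div_add_atTop_nhds_zero_nat (𝕜 := ℝ)))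
    simpa [hd, Function.comp_def] using h2
  simp only [EuclideanSpace.volume_ball, Fintype.card_fin]
  simpa using ENNReal.Tendsto.mul_const h1 (Or.inr ENNReal.ofReal_ne_top)

end Cells

/-! ### The Poincaré inequality in a bounded window -/

section Window

variable {d : ℕ} {Ω : Type*} [mΩ : MeasurableSpace Ω] {P : Measure Ω} {γ : ℝ≥0}
  {X : Ω → LocFinSet d}

/-- Poincaré inequality for the information in a bounded window. -/
lemma IsPoissonPointProcess.variance_condExp_le_lintegral [IsProbabilityMeasure P]
    (hX : IsPoissonPointProcess P γ X) (hd : d ≠ 0) {S : LocFinSet d → ℝ} (hS : Measurable S)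
    {M : ℝ} (hM : ∀ Y, |S Y| ≤ M) {W : Set (EuclideanSpace ℝ (Fin d))} (hW : MeasurableSet W)
    (hWb : Bornology.IsBounded W) :
    ENNReal.ofReal Var[P[fun ω => S (X ω) | sigmaOn X W]; P] ≤
      ∫⁻ ω, ∑' x : (X ω).carrier, ENNReal.ofReal
        ((S ((X ω).erase (x : EuclideanSpace ℝ (Fin d))) - S (X ω)) ^ 2) ∂P := by
  set V := ∫⁻ ω, ∑' x : (X ω).carrier, ENNReal.ofReal
        ((S ((X ω).erase (x : EuclideanSpace ℝ (Fin d))) - S (X ω)) ^ 2) ∂P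
  set C : ℝ≥0∞ := ENNReal.ofReal ((2 * M) ^ 2) * (γ ^ 2 * volume W) with hC
  have hCtop : C ≠ ∞ := ENNReal.mul_ne_top ENNReal.ofReal_ne_top
    (ENNReal.mul_ne_top (by simp) hWb.measure_lt_top.ne)
  -- Cells with at least two points contribute an error of the order of the volume of a cell.
  have hε : ∀ ε : ℝ, 0 < ε → ENNReal.ofReal Var[P[fun ω => S (X ω) | sigmaOn X W]; P] ≤
      V + C * volume (Metric.ball (0 : EuclideanSpace ℝ (Fin d)) ε) := by
    intro ε hε
    obtain ⟨B, N, hBm, hBd, hBv, hBW⟩ := exists_small_cells hW hWb hε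
    have hBsub : ∀ i < N, B i ⊆ W := fun i hi => hBW ▸ Set.subset_biUnion_of_mem (u := B) hi
    let J : ℕ → LocFinSet d → ℝ≥0∞ := fun i Y =>
      {Y : LocFinSet d | (Y.carrier ∩ B i).ncard = 1}.indicator
        (fun Y => ENNReal.ofReal ((S (Y.restrict (B i)ᶜ) - S Y) ^ 2)) Y
    have hdiff : ∀ i, Measurable fun Y : LocFinSet d => (S (Y.restrict (B i)ᶜ) - S Y) ^ 2 :=
      fun i => ((hS.comp (measurable_restrict (hBm i).compl)).sub hS).pow_const 2
    have hJm : ∀ i, Measurable (J i) := fun i =>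
      (ENNReal.measurable_ofReal.comp (hdiff i)).indicator
        (LocFinSet.measurable_ncard (hBm i) (measurableSet_singleton 1))
    have hJX : ∀ i, Measurable fun ω => J i (X ω) := fun i => (hJm i).comp hX.measurable
    have hcell : ∀ i < N, ENNReal.ofReal (∫ ω, (S (X ω) - S ((X ω).restrict (B i)ᶜ)) ^ 2 ∂P) ≤
        ∫⁻ ω, J i (X ω) ∂P + ENNReal.ofReal ((2 * M) ^ 2) * (γ * volume (B i)) ^ 2 := by
      intro i hi
      have hmeas2 : MeasurableSet {ω | 2 ≤ ((X ω).carrier ∩ B i).ncard} :=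
        hX.measurable_ncard (hBm i) (MeasurableSet.of_discrete (s := {n | 2 ≤ n}))
      have hsq : ∀ Y : LocFinSet d, (S Y - S (Y.restrict (B i)ᶜ)) ^ 2 ≤ (2 * M) ^ 2 := by
        intro Y
        have h1 := abs_le.1 (hM Y)
        have h2 := abs_le.1 (hM (Y.restrict (B i)ᶜ))
        exact sq_le_sq' (by linarith) (by linarith)
      rw [integral_eq_lintegral_of_nonneg_ae (.of_forall fun ω => sq_nonneg _)
        (by simpa only [sub_sq_comm, Function.comp_def] using
          ((hdiff i).comp hX.measurable).aestronglyMeasurable)]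
      refine ENNReal.ofReal_toReal_le.trans ?_
      have hpt : ∀ ω, ENNReal.ofReal ((S (X ω) - S ((X ω).restrict (B i)ᶜ)) ^ 2) ≤
          J i (X ω) + {ω | 2 ≤ ((X ω).carrier ∩ B i).ncard}.indicator
            (fun _ => ENNReal.ofReal ((2 * M) ^ 2)) ω := by
        intro ω
        have hfin := (X ω).finite_inter (B i) (hWb.subset (hBsub i hi))
        rcases (by lia : ((X ω).carrier ∩ B i).ncard = 0 ∨ ((X ω).carrier ∩ B i).ncard = 1 ∨
          2 ≤ ((X ω).carrier ∩ B i).ncard) with h | h | h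
        · rw [restrict_compl_eq_self ((Set.ncard_eq_zero hfin).1 h)]
          simp
        · have : J i (X ω) = ENNReal.ofReal ((S (X ω) - S ((X ω).restrict (B i)ᶜ)) ^ 2) := by
            simp only [J]
            rw [Set.indicator_of_mem (by exact h), sub_sq_comm]
          rw [this]
          exact le_self_add
        · rw [Set.indicator_of_mem (by exact h)]
          exact le_add_left (ENNReal.ofReal_le_ofReal (hsq _))
      refine (lintegral_mono hpt).trans ?_
      rw [lintegral_add_left (hJX i), lintegral_indicator_const hmeas2]
      gcongr
      exact hX.measure_two_le (hBm i) (hWb.subset (hBsub i hi))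
    have hES := hX.variance_condExp_le_sum hS hM hBm hBd N
    rw [hBW] at hES
    calc ENNReal.ofReal Var[P[fun ω => S (X ω) | sigmaOn X W]; P]
        ≤ ∑ i ∈ Finset.range N,
            ENNReal.ofReal (∫ ω, (S (X ω) - S ((X ω).restrict (B i)ᶜ)) ^ 2 ∂P) := by
          rw [← ENNReal.ofReal_sum_of_nonneg fun i _ => integral_nonneg fun ω => sq_nonneg _]
          exact ENNReal.ofReal_le_ofReal hES
      _ ≤ ∑ i ∈ Finset.range N,
            (∫⁻ ω, J i (X ω) ∂P + ENNReal.ofReal ((2 * M) ^ 2) * (γ * volume (B i)) ^ 2) :=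
          Finset.sum_le_sum fun i hi => hcell i (Finset.mem_range.1 hi)
      _ = ∫⁻ ω, ∑ i ∈ Finset.range N, J i (X ω) ∂P +
            ENNReal.ofReal ((2 * M) ^ 2) * ∑ i ∈ Finset.range N, (γ * volume (B i)) ^ 2 := by
          rw [Finset.sum_add_distrib, ← Finset.mul_sum,
            lintegral_finsetSum _ fun i _ => hJX i]
      _ ≤ V + ENNReal.ofReal ((2 * M) ^ 2) * (γ ^ 2 * volume W *
            volume (Metric.ball (0 : EuclideanSpace ℝ (Fin d)) ε)) := by
          gcongr ?_ + _ * ?_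
          · exact lintegral_mono fun ω => sum_cells_le_tsum_erase S (X ω) hBd N
          · have hWsum : ∑ i ∈ Finset.range N, volume (B i) = volume W := by
              rw [← hBW, ← measure_biUnion_finset (fun i _ j _ hij => hBd hij) fun i _ => hBm i]
              simp
            rw [← hWsum, Finset.mul_sum, Finset.sum_mul]
            refine Finset.sum_le_sum fun i _ => ?_
            rw [mul_pow, sq (volume (B i)), ← mul_assoc]
            exact mul_le_mul_right (hBv i) _
      _ = V + C * volume (Metric.ball (0 : EuclideanSpace ℝ (Fin d)) ε) := by
          rw [hC]; ring
  have hlim : Tendsto (fun n : ℕ => V + C * volume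
      (Metric.ball (0 : EuclideanSpace ℝ (Fin d)) (1 / (n + 1)))) atTop (𝓝 (V + C * 0)) :=
    (ENNReal.Tendsto.const_mul (tendsto_volume_ball_zero hd) (Or.inr hCtop)).const_add V
  rw [mul_zero, add_zero] at hlim
  exact ge_of_tendsto' hlim fun n => hε _ (by positivity)

end Window

/-! ### From windows to the whole space -/

section Limits

variable {d : ℕ} {Ω : Type*} [mΩ : MeasurableSpace Ω] {P : Measure Ω} {γ : ℝ≥0}
  {X : Ω → LocFinSet d}

/-- Dominated convergence for variances. -/
lemma tendsto_variance_of_dominated [IsProbabilityMeasure P] {F : ℕ → Ω → ℝ} {G b : Ω → ℝ}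
    (hF : ∀ n, AEStronglyMeasurable (F n) P) (hb : MemLp b 2 P)
    (hFb : ∀ n, ∀ᵐ ω ∂P, |F n ω| ≤ b ω)
    (hlim : ∀ᵐ ω ∂P, Tendsto (fun n => F n ω) atTop (𝓝 (G ω))) :
    Tendsto (fun n => Var[F n; P]) atTop (𝓝 Var[G; P]) := by
  have hGm : AEStronglyMeasurable G P := aestronglyMeasurable_of_tendsto_ae atTop hF hlim
  have hGb : ∀ᵐ ω ∂P, |G ω| ≤ b ω := by
    filter_upwards [ae_all_iff.2 hFb, hlim] with ω h1 h2
    exact le_of_tendsto' h2.abs h1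
  have hF2 : ∀ n, MemLp (F n) 2 P := fun n => hb.mono' (hF n) (hFb n)
  have hG2 : MemLp G 2 P := hb.mono' hGm hGb
  simp_rw [fun n => variance_eq_sub (hF2 n), variance_eq_sub hG2]
  refine Tendsto.sub ?_ (Tendsto.pow ?_ 2)
  · refine tendsto_integral_of_dominated_convergence (fun ω => b ω ^ 2) (fun n => (hF n).pow 2)
      hb.integrable_sq (fun n => ?_) ?_
    · filter_upwards [hFb n] with ω hω
      simpa using pow_le_pow_left₀ (abs_nonneg _) hω 2
    · filter_upwards [hlim] with ω hω using hω.pow 2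
  · exact tendsto_integral_of_dominated_convergence b hF (hb.integrable one_le_two) hFb hlim

/-- Poincaré inequality for bounded functionals. -/
lemma IsPoissonPointProcess.variance_le_lintegral_of_bounded [IsProbabilityMeasure P]
    (hX : IsPoissonPointProcess P γ X) (hd : d ≠ 0) {S : LocFinSet d → ℝ} (hS : Measurable S)
    {M : ℝ} (hM : ∀ Y, |S Y| ≤ M) :
    ENNReal.ofReal Var[fun ω => S (X ω); P] ≤
      ∫⁻ ω, ∑' x : (X ω).carrier, ENNReal.ofReal
        ((S ((X ω).erase (x : EuclideanSpace ℝ (Fin d))) - S (X ω)) ^ 2) ∂P := by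
  let ℱ : Filtration ℕ mΩ :=
    { seq := fun n => sigmaOn X (Metric.ball 0 n)
      mono' := fun m n hmn => sigmaOn_mono X measurableSet_ball
        (Metric.ball_subset_ball (Nat.cast_le.2 hmn))
      le' := fun n => sigmaOn_le hX.measurable measurableSet_ball }
  have hsup : sigmaOn X Set.univ ≤ ⨆ n, ℱ n := by
    refine (sigmaOn_le_iff .univ).2 fun A hA hAb _ => ?_
    obtain ⟨r, hr⟩ := hAb.subset_ball (0 : EuclideanSpace ℝ (Fin d))
    obtain ⟨n, hn⟩ := exists_nat_ge r
    exact (sigmaOn_le_iff measurableSet_ball).1 (le_iSup (fun n => ℱ n) n) A hA hAb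
      (hr.trans (Metric.ball_subset_ball hn))
  have hSX : StronglyMeasurable[⨆ n, ℱ n] fun ω => S (X ω) := by
    rw [sigmaOn_univ] at hsup
    exact (hS.comp (measurable_iff_comap_le.2 hsup)).stronglyMeasurable
  have hint : Integrable (fun ω => S (X ω)) P :=
    Integrable.of_bound (hS.comp hX.measurable).aestronglyMeasurable M (.of_forall fun ω => hM _)
  have hlevy := tendsto_ae_condExp (μ := P) (ℱ := ℱ) fun ω => S (X ω)
  rw [condExp_of_stronglyMeasurable (iSup_le ℱ.le) hSX hint] at hlevy
  have hvar := tendsto_variance_of_dominated (b := fun _ => M)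
    (fun n => integrable_condExp.aestronglyMeasurable) (memLp_const M)
    (fun n => ae_bdd_abs_condExp_of_ae_bdd_abs (.of_forall fun ω => hM (X ω))) hlevy
  exact le_of_tendsto' (ENNReal.tendsto_ofReal hvar) fun n =>
    hX.variance_condExp_le_lintegral hd hS hM measurableSet_ball Metric.isBounded_ball

/-- Poincaré inequality for square integrable functionals of a Poisson process. -/
theorem IsPoissonPointProcess.variance_le_lintegral [IsProbabilityMeasure P]
    (hX : IsPoissonPointProcess P γ X) (hd : d ≠ 0) {S : LocFinSet d → ℝ} (hS : Measurable S)
    (hS2 : MemLp (fun ω => S (X ω)) 2 P) :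
    ENNReal.ofReal Var[fun ω => S (X ω); P] ≤
      ∫⁻ ω, ∑' x : (X ω).carrier, ENNReal.ofReal
        ((S ((X ω).erase (x : EuclideanSpace ℝ (Fin d))) - S (X ω)) ^ 2) ∂P := by
  -- Truncation is a contraction, so it does not increase the right-hand side.
  let T : ℕ → ℝ → ℝ := fun n t => max (-(n : ℝ)) (min t n)
  have hTm : ∀ n, Measurable (T n) := fun n => by fun_prop
  have hTn : ∀ n t, |T n t| ≤ n := fun n t => abs_le.2
    ⟨le_max_left _ _, max_le (by linarith [n.cast_nonneg (α := ℝ)]) (min_le_right _ _)⟩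
  have hTt : ∀ n t, |T n t| ≤ |t| := by
    intro n t
    have hn := n.cast_nonneg (α := ℝ)
    simp only [T]
    grind
  have hTc : ∀ n s t, |T n s - T n t| ≤ |s - t| := by
    intro n s t
    simp only [T]
    rw [max_comm, max_comm (-(n : ℝ))]
    exact (abs_max_sub_max_le_abs _ _ _).trans (by simpa using abs_min_sub_min_le_max s n t n)
  have hTlim : ∀ t, Tendsto (fun n => T n t) atTop (𝓝 t) := by
    intro t
    obtain ⟨N, hN⟩ := exists_nat_ge |t|
    refine tendsto_const_nhds.congr' ?_
    filter_upwards [eventually_ge_atTop N] with n hn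
    have h := abs_le.1 (hN.trans (Nat.cast_le.2 hn))
    simp only [T]
    rw [min_eq_left h.2, max_eq_right h.1]
  have hvar := tendsto_variance_of_dominated (P := P) (F := fun n ω => T n (S (X ω)))
    (b := fun ω => |S (X ω)|)
    (fun n => ((hTm n).comp (hS.comp hX.measurable)).aestronglyMeasurable) hS2.abs
    (fun n => .of_forall fun ω => hTt n _) (.of_forall fun ω => hTlim _)
  refine le_of_tendsto' (ENNReal.tendsto_ofReal hvar) fun n => ?_
  refine (hX.variance_le_lintegral_of_bounded hd ((hTm n).comp hS) fun Y => hTn n _).trans ?_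
  refine lintegral_mono fun ω => ENNReal.tsum_le_tsum fun x => ENNReal.ofReal_le_ofReal ?_
  exact sq_le_sq.2 (hTc n _ _)

end Limits

theorem corollary5 {d : ℕ} {Ω : ℝ≥0 → Type*} [∀ γ, MeasurableSpace (Ω γ)]
    (P : ∀ γ, Measure (Ω γ)) [∀ γ, IsProbabilityMeasure (P γ)]
    (X : ∀ γ, Ω γ → LocFinSet d)
    (hX : ∀ γ : ℝ≥0, 0 < γ → IsPoissonPointProcess (P γ) γ (X γ))
    (lam : ℝ≥0) (hlam : 0 < lam)
    (S : LocFinSet d → ℝ) (hS : Measurable S)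
    (hS_fin : ∀ᶠ γ in 𝓝 lam, MemLp (fun ω => S (X γ ω)) 2 (P γ))
    (hS_cont : ContinuousAt (fun γ : ℝ≥0 => ∫ ω, S (X γ ω) ∂(P γ)) lam)
    (hS_sq_cont : ContinuousAt (fun γ : ℝ≥0 => ∫ ω, (S (X γ ω)) ^ 2 ∂(P γ)) lam)
    (R : LocFinSet d → ℝ) (f : ℝ → ℝ)
    (hR : ∀ᵐ ω ∂(P lam), IsRadiusOfInfluence S f (X lam ω) (R (X lam ω)))
    (hR_moment : Integrable
      (fun ω => (f (R (X lam ω))) ^ 2 * (R (X lam ω)) ^ (2 * d)) (P lam)) :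
    evariance (fun ω => S (X lam ω)) (P lam) ≤
      ∫⁻ ω, ∑' x : (X lam ω).carrier,
        ENNReal.ofReal ((S ((X lam ω).erase (x : EuclideanSpace ℝ (Fin d))) - S (X lam ω)) ^ 2)
          ∂(P lam) := by
  -- `𝓝 lam` contains `lam` itself, so square integrability holds at the intensity `lam`.
  have hlam2 : MemLp (fun ω => S (X lam ω)) 2 (P lam) := hS_fin.self_of_nhds
  rw [← ofReal_variance hlam2]
  exact (hX lam hlam).variance_le_lintegral ((hX lam hlam).dim_ne_zero hlam) hS hlam2
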